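/- **Theorem 3.1.** Let $d\ge 3$, and let $\mathbf m=(m_{i,j})$ be an integral $(d-1)\times d$-matrix with nonzero rows $m_1,\dots,m_{d-1}$ and with $m_{i,j}=0$ for $i<j$. Define $P_{\mathbf m}^{(1)}=\{e_1\}\subset\mathbb R^d$ and, for $2\le i\le d$, $$P_{\mathbf m}^{(i)}=\operatorname{conv}\Big(P_{\mathbf m}^{(i-1)}\cup\big\{(x_1,\dots,x_{i-1},\langle m_{i-1},x\rangle,0,\dots,0)\ :\ x=(x_1,\dots,x_{i-1},0,\dots,0)\in P_{\mathbf m}^{(i-1)}\big\}\Big),$$ and assume that $\mathbf m$ is admissible, i.e. $\langle m_{i},x\rangle\ge 0$ for all $x\in P_{\mathbf m}^{(i)}$ and all $1\le i\le d-1$. Let $P$ be a lattice polytope (with respect to $\mathbb Z^d$) contained in the hyperplane $\{x\in\mathbb R^d: x_1=1\}$ and lattice equivalent to the Nakajima polytope $P_{\mathbf m}^{(d)}$, i.e. there is an affine map which restricts to a bijection between the affine hulls and maps $P$ onto $P_{\mathbf m}^{(d)}$ and the points of $\mathbb Z^d$ in the affine hull of $P$ onto those in the affine hull of $P_{\mathbf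 m}^{(d)}$. For a polytope $Q$ in this hyperplane put $\tau_Q=\mathbb R_{\ge 0}\,Q$ and $U_{\tau_Q}=\operatorname{Spec}\mathbb C[(\mathbb Z^d)^\vee\cap\tau_Q^\vee]$. For $0\le i<j\le d-1$ define integers $\lambda_{i,j}$ recursively (with $i$ descending), and then integers $\mu_{i,j}$, by $\lambda_{0,j}=0$ and $$\lambda_{i,j}=\min\Big\{0,\ m_{j,i+1}+\sum_{k=i+1}^{j-1}m_{k,i+1}\lambda_{k,j}\Big\}\quad (1\le i\le j-1),$$ $$\mu_{0,j}=m_{j,1}+\sum_{k=1}^{j-1}m_{k,1}\lambda_{k,j},\qquad \mu_{i,j}=\max\Big\{0,\ m_{j,i+1}+\sum_{k=i+1}^{j-1}m_{k,i+1}\lambda_{k,j}\Big\}\quad (1\le i\le j-1).$$ Then $\lambda_{i,j}\le 0$ and $\mu_{i,j}\ge 0$ for all $0\le i<j\le d-1$, and there are isomorphisms of schemes over $\mathbb C$ $$U_{\tau_P}\;\cong\;U_{\tau_{P_{\mathbf m}^{(d)}}}\;\cong\;\operatorname{Spec}\big(\mathbb C[z_1,\dots,z_{2d-1}]/\mathcal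 I\big),$$ where $\mathcal I$ is the ideal generated by the $d-1$ binomials $$\prod_{1\le i\le j} z_i^{\mu_{i-1,j}}\,z_{d+i-1}^{-\lambda_{i-1,j}}\;-\;z_{j+1}\,z_{d+j},\qquad 1\le j\le d-1 .$$ -/

import Mathlib

namespace ToricLCI

/-! ### Lattice polytopes in `ℝ^d` and lattice equivalence -/

/-- The standard lattice `ℤ^d` inside `ℝ^d`. -/
def stdLattice (d : ℕ) : Set (Fin d → ℝ) :=
  Set.range fun (v : Fin d → ℤ) (k : Fin d) => (v k : ℝ)

/-- A (nonempty) lattice polytope of `ℝ^d`: the convex hull of finitely many points of `ℤ^d`. -/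
def IsLatticePolytope {d : ℕ} (P : Set (Fin d → ℝ)) : Prop :=
  ∃ s : Finset (Fin d → ℝ), s.Nonempty ∧ (s : Set (Fin d → ℝ)) ⊆ stdLattice d ∧
    P = convexHull ℝ (s : Set (Fin d → ℝ))

/-- The affine hyperplane `x₁ = 1` of `ℝ^d` (the first coordinate has index `0` in `Fin d`). -/
def hyperplaneOne (d : ℕ) : Set (Fin d → ℝ) :=
  {x | ∀ k : Fin d, (k : ℕ) = 0 → x k = 1}

/-- Lattice equivalence of two lattice polytopes: there is an affine map which restricts to a
bijection between the affine hulls, maps the one polytope onto the other, and maps the lattice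
points of the one affine hull onto the lattice points of the other. (An affine bijection of the
affine hulls that maps `P` onto `Q` maps the `i`-dimensional faces of `P` onto the
`i`-dimensional faces of `Q`.) -/
def LatticeEquivalent {m n : ℕ} (P : Set (Fin m → ℝ)) (Q : Set (Fin n → ℝ)) : Prop :=
  ∃ w : (Fin m → ℝ) →ᵃ[ℝ] (Fin n → ℝ),
    Set.BijOn w (affineSpan ℝ P : Set (Fin m → ℝ)) (affineSpan ℝ Q : Set (Fin n → ℝ)) ∧
    w '' P = Q ∧
    w '' ((affineSpan ℝ P : Set (Fin m → ℝ)) ∩ stdLattice m) =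
      (affineSpan ℝ Q : Set (Fin n → ℝ)) ∩ stdLattice n

/-! ### Free parameters and Nakajima polytopes -/

/-- The entry `m_{i,j}` of a `(d-1) × d` matrix with the indices counted from `1`, that is
`1 ≤ i ≤ d - 1` and `1 ≤ j ≤ d`; the value is `0` for indices outside this range. -/
def entry {d : ℕ} (m : Matrix (Fin (d - 1)) (Fin d) ℤ) (i j : ℕ) : ℤ :=
  if h : (1 ≤ i ∧ i ≤ d - 1) ∧ (1 ≤ j ∧ j ≤ d) then
    m ⟨i - 1, by omega⟩ ⟨j - 1, by omega⟩
  else 0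

/-- A sequence of free parameters of length `d - 1` with respect to `ℤ^d`: the rows
`m_1, …, m_{d-1}` are nonzero and `m_{i,j} = 0` for `i < j`. -/
def IsFreeParameterMatrix {d : ℕ} (m : Matrix (Fin (d - 1)) (Fin d) ℤ) : Prop :=
  (∀ r, m r ≠ 0) ∧ ∀ i j : ℕ, i < j → entry m i j = 0

/-- The pairing `⟨m_i, x⟩` of the `i`-th row (counted from `1`) with `x ∈ ℝ^d`. -/
noncomputable def rowPairing {d : ℕ} (m : Matrix (Fin (d - 1)) (Fin d) ℤ) (i : ℕ)
    (x : Fin d → ℝ) : ℝ :=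
  ∑ l : Fin d, (entry m i ((l : ℕ) + 1) : ℝ) * x l

/-- The sets `P_m^{(i)} ⊆ ℝ^d` for `i ≥ 1` (the value at `0` is not used): `P_m^{(1)} = {e₁}`, and
`P_m^{(i+1)}` is the convex hull of the union of `P_m^{(i)}` and of the set of the points
`(x₁, …, x_i, ⟨m_i, x⟩, 0, …, 0)` with `x = (x₁, …, x_i, 0, …, 0) ∈ P_m^{(i)}`. The `(i+1)`-st
coordinate is the one of index `i` in `Fin d`. -/
noncomputable def nakajimaPolytope {d : ℕ} (m : Matrix (Fin (d - 1)) (Fin d) ℤ) :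
    ℕ → Set (Fin d → ℝ)
  | 0 => ∅
  | 1 => {fun k : Fin d => if (k : ℕ) = 0 then 1 else 0}
  | i + 2 => convexHull ℝ (nakajimaPolytope m (i + 1) ∪
      (fun (x : Fin d → ℝ) (k : Fin d) => if (k : ℕ) = i + 1 then rowPairing m (i + 1) x else x k)
        '' nakajimaPolytope m (i + 1))

/-- Admissible free-parameter matrices: `⟨m_i, x⟩ ≥ 0` on `P_m^{(i)}` for `1 ≤ i ≤ d - 1`. -/
def IsAdmissible {d : ℕ} (m : Matrix (Fin (d - 1)) (Fin d) ℤ) : Prop :=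
  IsFreeParameterMatrix m ∧
    ∀ i : ℕ, 1 ≤ i → i ≤ d - 1 → ∀ x ∈ nakajimaPolytope m i, 0 ≤ rowPairing m i x

/-! ### Affine toric varieties -/

/-- The cone `τ_P = pos(P) = {κ x | κ ≥ 0, x ∈ P}` over a polytope `P`. -/
def coneOver {d : ℕ} (P : Set (Fin d → ℝ)) : Set (Fin d → ℝ) :=
  {y | ∃ κ : ℝ, 0 ≤ κ ∧ ∃ x ∈ P, y = κ • x}

/-- The monoid `(ℤ^d)^∨ ∩ σ^∨` of the integral linear forms (written as row vectors) that are
nonnegative on `σ ⊆ ℝ^d`. -/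
def dualMonoid {d : ℕ} (σ : Set (Fin d → ℝ)) : AddSubmonoid (Fin d → ℤ) where
  carrier := {y | ∀ x ∈ σ, 0 ≤ ∑ l : Fin d, (y l : ℝ) * x l}
  zero_mem' := by
    intro x _
    simp
  add_mem' := by
    intro a b ha hb x hx
    have h := add_nonneg (ha x hx) (hb x hx)
    rw [← Finset.sum_add_distrib] at h
    refine h.trans_eq (Finset.sum_congr rfl fun l _ => ?_)
    simp only [Pi.add_apply]
    push_cast
    ring

/-- `Spec A` as a scheme over `Spec ℂ`, for a commutative `ℂ`-algebra `A`. -/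
noncomputable def specOver (A : Type) [CommRing A] [Algebra ℂ A] :
    CategoryTheory.Over (AlgebraicGeometry.Spec (CommRingCat.of ℂ)) :=
  CategoryTheory.Over.mk
    (AlgebraicGeometry.Spec.map (CommRingCat.ofHom (algebraMap ℂ A)))

/-- The affine toric variety `U_σ = Spec ℂ[(ℤ^d)^∨ ∩ σ^∨]`, as a scheme over `ℂ`. -/
noncomputable def toricVariety {d : ℕ} (σ : Set (Fin d → ℝ)) :
    CategoryTheory.Over (AlgebraicGeometry.Spec (CommRingCat.of ℂ)) :=
  specOver (AddMonoidAlgebra ℂ (dualMonoid σ))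

/-! ### The exponents and the binomial ideal -/

/-- The integers `λ_{i,j}`, by descending recursion on `i` (see `lam_eq`). -/
def lam {d : ℕ} (m : Matrix (Fin (d - 1)) (Fin d) ℤ) (i j : ℕ) : ℤ :=
  if i = 0 then 0
  else min 0 (entry m j (i + 1) +
    ∑ k ∈ (Finset.Ioo i j).attach, entry m k.1 (i + 1) * lam m k.1 j)
termination_by j - i
decreasing_by
  have hk := Finset.mem_Ioo.mp k.2
  omega

/-- The recursion: `λ_{0,j} = 0`, and
`λ_{i,j} = min {0, m_{j,i+1} + ∑_{k=i+1}^{j-1} m_{k,i+1} λ_{k,j}}` for `1 ≤ i ≤ j - 1`, where the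
sum is empty for `i = j - 1`. -/
theorem lam_eq {d : ℕ} (m : Matrix (Fin (d - 1)) (Fin d) ℤ) (i j : ℕ) :
    lam m i j = if i = 0 then 0
      else min 0 (entry m j (i + 1) + ∑ k ∈ Finset.Ioo i j, entry m k (i + 1) * lam m k j) := by
  rw [lam, Finset.sum_attach (Finset.Ioo i j) fun k => entry m k (i + 1) * lam m k j]

/-- The integers `μ_{i,j}`: `μ_{0,j} = m_{j,1} + ∑_{k=1}^{j-1} m_{k,1} λ_{k,j}`, and
`μ_{i,j} = max {0, m_{j,i+1} + ∑_{k=i+1}^{j-1} m_{k,i+1} λ_{k,j}}` for `1 ≤ i ≤ j - 1`. -/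
def mu {d : ℕ} (m : Matrix (Fin (d - 1)) (Fin d) ℤ) (i j : ℕ) : ℤ :=
  if i = 0 then entry m j 1 + ∑ k ∈ Finset.Ioo 0 j, entry m k 1 * lam m k j
  else max 0 (entry m j (i + 1) + ∑ k ∈ Finset.Ioo i j, entry m k (i + 1) * lam m k j)

/-- The variable `z_i` of `ℂ[z_1, …, z_{2d-1}]`, for `1 ≤ i ≤ 2d - 1` (and `0` otherwise). -/
noncomputable def zvar (d i : ℕ) : MvPolynomial (Fin (2 * d - 1)) ℂ :=
  if h : 1 ≤ i ∧ i ≤ 2 * d - 1 then MvPolynomial.X ⟨i - 1, by omega⟩ else 0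

/-- The binomial `∏_{1 ≤ i ≤ j} z_i ^ μ_{i-1,j} z_{d+i-1} ^ (-λ_{i-1,j}) - z_{j+1} z_{d+j}`. -/
noncomputable def binomial {d : ℕ} (m : Matrix (Fin (d - 1)) (Fin d) ℤ) (j : ℕ) :
    MvPolynomial (Fin (2 * d - 1)) ℂ :=
  (∏ i ∈ Finset.Icc 1 j,
      zvar d i ^ (mu m (i - 1) j).toNat * zvar d (d + i - 1) ^ (-lam m (i - 1) j).toNat) -
    zvar d (j + 1) * zvar d (d + j)

/-- The ideal generated by the `d - 1` binomials with `1 ≤ j ≤ d - 1`. -/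
noncomputable def binomialIdeal {d : ℕ} (m : Matrix (Fin (d - 1)) (Fin d) ℤ) :
    Ideal (MvPolynomial (Fin (2 * d - 1)) ℂ) :=
  Ideal.span (binomial m '' Set.Icc 1 (d - 1))

end ToricLCI

/-!
The polytope `P_m^{(n+1)}` is the region between `0` and `⟨m_n, x⟩` over `P_m^{(n)}`. Hence a form
`y + s e_{n+1}`, with `y` in the first `n` coordinates, is nonnegative on it if and only if `y`
(for `s ≥ 0`) or `y + s m_n` (for `s ≤ 0`) is nonnegative on `P_m^{(n)}`. The dual monoid of the
cone is therefore built up by adjoining, in each step, two generators `e_{n+1}` and `m_n - e_{n+1}`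
(`coordForm` and `boundForm`), whose sum `m_n` lies in the monoid already constructed; see
`exists_generators`. The exponents `μ` and `-λ` express `m_n` through the earlier generators
(`rowForm_eq_sum`), so that the binomials are exactly the relations `e_{n+1} + (m_n - e_{n+1}) = m_n`
in multiplicative form. The integer `μ_{0,n}` is the value of `m_n` at a suitable vertex, hence
nonnegative (`mu_nonneg`).

No further relations are needed (`prod_eq_of_weight_eq`): modulo the binomials a monomial can be
rewritten, from the last pair of variables to the first, until it contains at most one variable of
each pair `z_{j+1}`, `z_{d+j}`, and the exponents of such a monomial can be read off its weight.

A lattice equivalence of polytopes of full dimension in `x_1 = 1` extends to a linear automorphism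
of `ℝ^d` preserving `ℤ^d`, because `ℤ^d` is generated by its points in that hyperplane; the
transposed matrix identifies the dual monoids (`nonempty_dualMonoid_equiv`).
-/

namespace ToricLCI

/-! ### Spectra -/

open CategoryTheory in
/-- Isomorphic `ℂ`-algebras have isomorphic spectra over `ℂ`. -/
theorem nonempty_specOver_iso {A B : Type} [CommRing A] [CommRing B] [Algebra ℂ A] [Algebra ℂ B]
    (φ : A ≃ₐ[ℂ] B) : Nonempty (specOver A ≅ specOver B) := by
  refine ⟨Over.isoMk (AlgebraicGeometry.Scheme.Spec.mapIso
    φ.toRingEquiv.symm.toCommRingCatIso.op) ?_⟩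
  simp only [specOver, Over.mk_hom, Functor.mapIso_hom, Iso.op_hom,
    AlgebraicGeometry.Scheme.Spec_map, Quiver.Hom.unop_op]
  rw [← AlgebraicGeometry.Spec.map_comp, ← CommRingCat.ofHom_hom (CommRingCat.ofHom _ ≫ _)]
  congr 1
  ext x
  exact φ.symm.commutes x

/-! ### Monoid algebras by generators and relations -/

/-- A presentation of a monoid algebra: if every element of `S` is the weight `g a` of
some monomial `z^a`, and `I` contains every difference of two monomials of the same weight but
nothing outside the kernel of `z^a ↦ g a`, then `k[z] / I ≃ k[S]`. -/
theorem nonempty_quotient_algEquiv {k σ S : Type*} [CommRing k] [AddCommMonoid S]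
    (I : Ideal (MvPolynomial σ k)) (g : (σ →₀ ℕ) →+ S) (hg : Function.Surjective g)
    (hker : I ≤ RingHom.ker (AddMonoidAlgebra.mapDomainAlgHom k k g))
    (hI : ∀ a b, g a = g b →
      MvPolynomial.monomial a (1 : k) - MvPolynomial.monomial b 1 ∈ I) :
    Nonempty ((MvPolynomial σ k ⧸ I) ≃ₐ[k] AddMonoidAlgebra k S) := by
  let ψ : MvPolynomial σ k →ₐ[k] AddMonoidAlgebra k S := AddMonoidAlgebra.mapDomainAlgHom k k g
  have hψ : ∀ a c, ψ (MvPolynomial.monomial a c) = AddMonoidAlgebra.single (g a) c := fun a c =>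
    AddMonoidAlgebra.mapDomain_single
  let φ : (MvPolynomial σ k ⧸ I) →ₐ[k] AddMonoidAlgebra k S :=
    Ideal.Quotient.liftₐ I ψ fun a ha => hker ha
  let s : S → (σ →₀ ℕ) := Function.surjInv hg
  have hker' : ∀ p, ψ p = 0 → p ∈ I := by
    intro p hp
    -- The additive map sending `single t c` to `c` times the class of a chosen
    -- monomial of weight `t` inverts `φ`.
    let τ : (S →₀ k) →+ MvPolynomial σ k ⧸ I := Finsupp.liftAddHom fun t =>
      ((Ideal.Quotient.mk I : MvPolynomial σ k →+ MvPolynomial σ k ⧸ I)).comp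
        (MvPolynomial.monomial (s t)).toAddMonoidHom
    have hτ : ∀ p, τ (ψ p).coeff = Ideal.Quotient.mk I p := by
      intro p
      induction p using MvPolynomial.induction_on' with
      | monomial a c =>
        rw [hψ, AddMonoidAlgebra.coeff_single, Finsupp.liftAddHom_apply_single]
        refine Ideal.Quotient.eq.2 ?_
        have := I.mul_mem_left (MvPolynomial.C c) (hI (s (g a)) a (Function.surjInv_eq hg _))
        rwa [mul_sub, MvPolynomial.C_mul_monomial, MvPolynomial.C_mul_monomial, mul_one] at this
      | add p q hp hq =>
        rw [map_add, AddMonoidAlgebra.coeff_add, map_add, hp, hq, map_add]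
    rw [← Ideal.Quotient.eq_zero_iff_mem, ← hτ, hp, AddMonoidAlgebra.coeff_zero, map_zero]
  refine ⟨AlgEquiv.ofBijective φ ⟨?_, ?_⟩⟩
  · rw [injective_iff_map_eq_zero]
    intro x hx
    obtain ⟨p, rfl⟩ := Ideal.Quotient.mk_surjective x
    exact Ideal.Quotient.eq_zero_iff_mem.2 (hker' p hx)
  · intro y
    induction y using AddMonoidAlgebra.induction_linear with
    | zero => exact ⟨0, map_zero _⟩
    | add x y hx hy =>
      obtain ⟨a, rfl⟩ := hx
      obtain ⟨b, rfl⟩ := hy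
      exact ⟨a + b, map_add _ _ _⟩
    | single t c =>
      obtain ⟨a, rfl⟩ := hg t
      exact ⟨Ideal.Quotient.mk I (MvPolynomial.monomial a c), hψ a c⟩

/-- Suppose that generators `E n`, `F n` of a commutative monoid satisfy relations expressing
`E n * F n` as a monomial in the generators of smaller index, and that `e n`, `f n` are weights
compatible with these relations. If the weights are triangular with diagonal entries `1` (for `e`)
and `-1` (for `f`), then monomials of equal weight are equal: by the relation only the difference
of the exponents of `E n` and `F n` matters, and the weight determines it. The generators of index
`0` are not paired, which is encoded by `F 0 = 1` and `f 0 = 0`. -/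
theorem prod_eq_of_weight_eq {A V : Type*} [CommMonoid A] [AddCommGroup V] {N : ℕ}
    {E F : ℕ → A} {e f : ℕ → V} {c : ℕ → V →+ ℤ} {p q : ℕ → ℕ → ℕ}
    (hF : F 0 = 1) (hf : f 0 = 0)
    (hce : ∀ n < N, ∀ i < n, c n (e i) = 0) (hcf : ∀ n < N, ∀ i < n, c n (f i) = 0)
    (hce' : ∀ n < N, c n (e n) = 1) (hcf' : ∀ n < N, n ≠ 0 → c n (f n) = -1)
    (hrel : ∀ n < N, n ≠ 0 → E n * F n = ∏ i ∈ Finset.range n, E i ^ p i n * F i ^ q i n)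
    (hwt : ∀ n < N, n ≠ 0 → e n + f n = ∑ i ∈ Finset.range n, (p i n • e i + q i n • f i)) :
    ∀ n ≤ N, ∀ u v u' v' : ℕ → ℕ,
      ∑ i ∈ Finset.range n, (u i • e i + v i • f i) =
        ∑ i ∈ Finset.range n, (u' i • e i + v' i • f i) →
      ∏ i ∈ Finset.range n, E i ^ u i * F i ^ v i =
        ∏ i ∈ Finset.range n, E i ^ u' i * F i ^ v' i := by
  intro n
  induction n with
  | zero => intros; rfl
  | succ n ih =>
    intro hn u v u' v' h
    have hn' : n < N := hn
    have hcsum : ∀ u v : ℕ → ℕ, c n (∑ i ∈ Finset.range n, (u i • e i + v i • f i)) = 0 := by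
      intro u v
      rw [map_sum]
      refine Finset.sum_eq_zero fun i hi => ?_
      rw [map_add, map_nsmul, map_nsmul, hce n hn' i (Finset.mem_range.1 hi),
        hcf n hn' i (Finset.mem_range.1 hi)]
      simp
    have hcoord := congrArg (c n) h
    simp only [Finset.sum_range_succ, map_add, hcsum, map_nsmul, hce' n hn', zero_add] at hcoord
    rcases eq_or_ne n 0 with rfl | h0
    · simp only [hf, map_zero] at hcoord
      have : u 0 = u' 0 := by simpa using hcoord
      simp [hF, this]
    · rw [hcf' n hn' h0] at hcoord
      have hcoord : (u n : ℤ) - v n = u' n - v' n := by simpa [sub_eq_add_neg] using hcoord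
      -- Cancel the common part `r` of the exponents of `E n` and `F n`.
      have key : ∀ (u v : ℕ → ℕ) (r s t : ℕ), u n = r + s → v n = r + t →
          ∑ i ∈ Finset.range (n + 1), (u i • e i + v i • f i) =
            ∑ i ∈ Finset.range n, ((u i + r * p i n) • e i + (v i + r * q i n) • f i) +
              (s • e n + t • f n) ∧
          ∏ i ∈ Finset.range (n + 1), E i ^ u i * F i ^ v i =
            (∏ i ∈ Finset.range n, E i ^ (u i + r * p i n) * F i ^ (v i + r * q i n)) *
              (E n ^ s * F n ^ t) := by
        intro u v r s t hu hv
        constructor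
        · rw [Finset.sum_range_succ, hu, hv]
          have : (r + s) • e n + (r + t) • f n = r • (e n + f n) + (s • e n + t • f n) := by
            rw [add_smul, add_smul, smul_add]; abel
          rw [this, hwt n hn' h0, ← add_assoc, Finset.smul_sum, ← Finset.sum_add_distrib]
          congr 1
          refine Finset.sum_congr rfl fun i _ => ?_
          rw [add_smul, add_smul, smul_add, mul_smul, mul_smul]; abel
        · rw [Finset.prod_range_succ, hu, hv]
          have : E n ^ (r + s) * F n ^ (r + t) = (E n * F n) ^ r * (E n ^ s * F n ^ t) := by
            rw [pow_add, pow_add, mul_pow, mul_mul_mul_comm]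
          rw [this, hrel n hn' h0, ← mul_assoc, ← Finset.prod_pow, ← Finset.prod_mul_distrib]
          congr 1
          refine Finset.prod_congr rfl fun i _ => ?_
          rw [pow_add, pow_add, mul_pow, ← pow_mul, ← pow_mul, mul_mul_mul_comm, mul_comm r,
            mul_comm r]
      obtain ⟨r, r', s, t, hu, hv, hu', hv'⟩ : ∃ r r' s t, u n = r + s ∧ v n = r + t ∧
          u' n = r' + s ∧ v' n = r' + t :=
        ⟨min (u n) (v n), min (u' n) (v' n), u n - min (u n) (v n), v n - min (u n) (v n),
          by omega, by omega, by omega, by omega⟩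
      obtain ⟨k₁, k₂⟩ := key u v r s t hu hv
      obtain ⟨k₁', k₂'⟩ := key u' v' r' s t hu' hv'
      rw [k₁, k₁'] at h
      rw [k₂, k₂', ih hn'.le _ _ _ _ (add_right_cancel h)]

variable {d : ℕ}

/-! ### Integral linear forms -/

/-- The integral row vector `y`, regarded as a linear form on `ℝ^d`. -/
noncomputable def evalForm (d : ℕ) : (Fin d → ℤ) →+ ((Fin d → ℝ) →ₗ[ℝ] ℝ) where
  toFun y := ∑ l, (y l : ℝ) • LinearMap.proj l
  map_zero' := by simp
  map_add' a b := by simp [add_smul, Finset.sum_add_distrib]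

theorem evalForm_apply (y : Fin d → ℤ) (x : Fin d → ℝ) :
    evalForm d y x = ∑ l, (y l : ℝ) * x l := by
  simp [evalForm]

/-- The coordinate form `e_{k+1}` of `ℝ^d` (zero for `k ≥ d`). -/
def coordForm (d k : ℕ) : Fin d → ℤ := fun l => if (l : ℕ) = k then 1 else 0

/-- The `k`-th row of `m` (counted from `1`) as an integral linear form. -/
def rowForm (m : Matrix (Fin (d - 1)) (Fin d) ℤ) (k : ℕ) : Fin d → ℤ :=
  fun l => entry m k ((l : ℕ) + 1)

/-- The form `m_k - e_{k+1}`, whose nonnegativity is the upper bound `x_{k+1} ≤ ⟨m_k, x⟩`. There is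
no such bound for the first coordinate, and the value at `k = 0` is `0`. -/
def boundForm (m : Matrix (Fin (d - 1)) (Fin d) ℤ) (k : ℕ) : Fin d → ℤ :=
  if k = 0 then 0 else rowForm m k - coordForm d k

theorem evalForm_coordForm {k : ℕ} (hk : k < d) (x : Fin d → ℝ) :
    evalForm d (coordForm d k) x = x ⟨k, hk⟩ := by
  rw [evalForm_apply, Finset.sum_eq_single ⟨k, hk⟩]
  · simp [coordForm]
  · intro l _ hl
    have : (l : ℕ) ≠ k := fun h => hl (Fin.ext h)
    simp [coordForm, this]
  · simp

theorem evalForm_rowForm (m : Matrix (Fin (d - 1)) (Fin d) ℤ) (k : ℕ) (x : Fin d → ℝ) :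
    evalForm d (rowForm m k) x = rowPairing m k x :=
  evalForm_apply _ _

theorem mem_dualMonoid_coneOver {P : Set (Fin d → ℝ)} {y : Fin d → ℤ} :
    y ∈ dualMonoid (coneOver P) ↔ ∀ x ∈ P, 0 ≤ evalForm d y x := by
  change (∀ x ∈ coneOver P, 0 ≤ ∑ l, (y l : ℝ) * x l) ↔ _
  simp only [← evalForm_apply]
  constructor
  · intro h x hx
    exact h x ⟨1, zero_le_one, x, hx, (one_smul _ _).symm⟩
  · rintro h _ ⟨κ, hκ, x, hx, rfl⟩
    rw [map_smul]
    exact mul_nonneg hκ (h x hx)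

/-! ### Nakajima polytopes -/

/-- The point `(x_1, …, x_n, ⟨m_n, x⟩, 0, …, 0)` of the graph over `P_m^{(n)}`. -/
noncomputable def graphPoint (m : Matrix (Fin (d - 1)) (Fin d) ℤ) (n : ℕ) (x : Fin d → ℝ) :
    Fin d → ℝ :=
  fun k => if (k : ℕ) = n then rowPairing m n x else x k

theorem nakajimaPolytope_succ (m : Matrix (Fin (d - 1)) (Fin d) ℤ) {n : ℕ} (hn : n ≠ 0) :
    nakajimaPolytope m (n + 1) =
      convexHull ℝ (nakajimaPolytope m n ∪ graphPoint m n '' nakajimaPolytope m n) := by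
  obtain ⟨i, rfl⟩ := Nat.exists_eq_succ_of_ne_zero hn
  rfl

theorem nakajimaPolytope_subset_succ (m : Matrix (Fin (d - 1)) (Fin d) ℤ) {n : ℕ} (hn : n ≠ 0) :
    nakajimaPolytope m n ⊆ nakajimaPolytope m (n + 1) := by
  rw [nakajimaPolytope_succ m hn]
  exact Set.subset_union_left.trans (subset_convexHull ℝ _)

theorem graphPoint_mem (m : Matrix (Fin (d - 1)) (Fin d) ℤ) {n : ℕ} (hn : n ≠ 0) {x : Fin d → ℝ}
    (hx : x ∈ nakajimaPolytope m n) : graphPoint m n x ∈ nakajimaPolytope m (n + 1) := by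
  rw [nakajimaPolytope_succ m hn]
  exact subset_convexHull ℝ _ (Or.inr ⟨x, hx, rfl⟩)

/-- Forms that do not involve the coordinate of index `n` do not distinguish `x` from the point of
the graph over `x`. -/
theorem evalForm_graphPoint (m : Matrix (Fin (d - 1)) (Fin d) ℤ) {n : ℕ} {y : Fin d → ℤ}
    (hy : ∀ l : Fin d, (l : ℕ) = n → y l = 0) (x : Fin d → ℝ) :
    evalForm d y (graphPoint m n x) = evalForm d y x := by
  rw [evalForm_apply, evalForm_apply]
  refine Finset.sum_congr rfl fun l _ => ?_
  by_cases h : (l : ℕ) = n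
  · simp [hy l h]
  · simp [graphPoint, h]

theorem rowForm_eq_zero {m : Matrix (Fin (d - 1)) (Fin d) ℤ} (hm : IsAdmissible m) {k : ℕ}
    {l : Fin d} (h : k ≤ l) : rowForm m k l = 0 :=
  hm.1.2 k (l + 1) (by omega)

theorem rowPairing_graphPoint {m : Matrix (Fin (d - 1)) (Fin d) ℤ} (hm : IsAdmissible m) {k n : ℕ}
    (hk : k ≤ n) (x : Fin d → ℝ) : rowPairing m k (graphPoint m n x) = rowPairing m k x := by
  rw [← evalForm_rowForm, ← evalForm_rowForm]
  exact evalForm_graphPoint m (fun l hl => rowForm_eq_zero hm (by omega)) x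

/-- The inequalities describing `P_m^{(n)}`. -/
theorem nakajimaPolytope_bounds {m : Matrix (Fin (d - 1)) (Fin d) ℤ} (hm : IsAdmissible m)
    {n : ℕ} (hn : n ≠ 0) (hnd : n ≤ d) : ∀ x ∈ nakajimaPolytope m n, ∀ k : Fin d,
      ((k : ℕ) = 0 → x k = 1) ∧ (n ≤ k → x k = 0) ∧ 0 ≤ x k ∧
        ((k : ℕ) ≠ 0 → (k : ℕ) < n → x k ≤ rowPairing m k x) := by
  induction n with
  | zero => exact absurd rfl hn
  | succ n ih =>
    rcases eq_or_ne n 0 with rfl | h0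
    · rintro x hx k
      obtain rfl := Set.mem_singleton_iff.1 hx
      refine ⟨fun h => if_pos h, fun h => if_neg (by omega), ?_, fun h h' => by omega⟩
      dsimp only
      split_ifs <;> norm_num
    · specialize ih h0 (by omega)
      intro x hx
      rw [nakajimaPolytope_succ m h0] at hx
      refine convexHull_min (t := {x : Fin d → ℝ | ∀ k : Fin d,
        ((k : ℕ) = 0 → x k = 1) ∧ (n + 1 ≤ k → x k = 0) ∧ 0 ≤ x k ∧
          ((k : ℕ) ≠ 0 → (k : ℕ) < n + 1 → x k ≤ rowPairing m k x)})
        (Set.union_subset ?_ ?_) ?_ hx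
      · intro x hx k
        obtain ⟨h1, h2, h3, h4⟩ := ih x hx k
        refine ⟨h1, fun h => h2 (by omega), h3, fun hk hk' => ?_⟩
        rcases Nat.lt_or_ge k n with h | h
        · exact h4 hk h
        · rw [h2 h]
          obtain rfl : n = k := by omega
          exact hm.2 _ (by omega) (by omega) x hx
      · rintro _ ⟨x, hx, rfl⟩ k
        obtain ⟨h1, h2, h3, h4⟩ := ih x hx k
        by_cases hk : (k : ℕ) = n
        · have hval : graphPoint m n x k = rowPairing m n x := if_pos hk
          refine ⟨fun h => by omega, fun h => by omega, ?_, fun _ _ => ?_⟩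
          · rw [hval]
            exact hm.2 n (by omega) (by omega) x hx
          · rw [hval, hk, rowPairing_graphPoint hm le_rfl]
        · have hval : graphPoint m n x k = x k := if_neg hk
          rw [hval]
          refine ⟨h1, fun h => h2 (by omega), h3, fun h h' => ?_⟩
          rw [rowPairing_graphPoint hm (by omega)]
          exact h4 h (by omega)
      · intro x hx y hy a b ha hb hab k
        obtain ⟨h1, h2, h3, h4⟩ := hx k
        obtain ⟨h1', h2', h3', h4'⟩ := hy k
        simp only [Pi.add_apply, Pi.smul_apply, smul_eq_mul]
        refine ⟨fun h => ?_, fun h => ?_, by positivity, fun h h' => ?_⟩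
        · rw [h1 h, h1' h, mul_one, mul_one, hab]
        · rw [h2 h, h2' h, mul_zero, mul_zero, add_zero]
        · rw [← evalForm_rowForm, map_add, map_smul, map_smul, evalForm_rowForm, evalForm_rowForm]
          exact add_le_add (mul_le_mul_of_nonneg_left (h4 h h') ha)
            (mul_le_mul_of_nonneg_left (h4' h h') hb)

/-- Every choice, for each coordinate after the first, of one of its two bounds `0` and `⟨m_k, x⟩`
is attained at a point of `P_m^{(n)}`. -/
theorem exists_vertex {m : Matrix (Fin (d - 1)) (Fin d) ℤ} (hm : IsAdmissible m)
    (c : ℕ → Prop) {n : ℕ} (hn : n ≠ 0) (hnd : n ≤ d) : ∃ x ∈ nakajimaPolytope m n, ∀ k : Fin d,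
      (k : ℕ) ≠ 0 → (k : ℕ) < n → (c k → x k = rowPairing m k x) ∧ (¬ c k → x k = 0) := by
  induction n with
  | zero => exact absurd rfl hn
  | succ n ih =>
    rcases eq_or_ne n 0 with rfl | h0
    · exact ⟨_, rfl, fun k h h' => by omega⟩
    · obtain ⟨x, hx, hxk⟩ := ih h0 (by omega)
      by_cases hc : c n
      · refine ⟨_, graphPoint_mem m h0 hx, fun k hk hk' => ?_⟩
        rw [rowPairing_graphPoint hm (by omega)]
        by_cases h : (k : ℕ) = n
        · rw [h]
          exact ⟨fun _ => if_pos h, fun h' => absurd hc h'⟩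
        · have hval : graphPoint m n x k = x k := if_neg h
          rw [hval]
          exact hxk k hk (by omega)
      · refine ⟨x, nakajimaPolytope_subset_succ m h0 hx, fun k hk hk' => ?_⟩
        rcases Nat.lt_or_ge k n with h | h
        · exact hxk k hk h
        · obtain rfl : n = k := by omega
          exact ⟨fun h' => absurd h' hc,
            fun _ => (nakajimaPolytope_bounds hm h0 (by omega) x hx k).2.1 le_rfl⟩

/-- The forms nonnegative on `P_m^{(n)}` are generated by the coordinate and the bound forms: if the
last coefficient `s` of `y` is nonnegative, subtract `s • coordForm`; otherwise subtract
`|s| • boundForm`, which stays nonnegative because `y` is so on the graph over `P_m^{(n-1)}`. -/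
theorem exists_generators {m : Matrix (Fin (d - 1)) (Fin d) ℤ} (hm : IsAdmissible m)
    {n : ℕ} (hn : n ≠ 0) (hnd : n ≤ d) (y : Fin d → ℤ) (hy0 : ∀ l : Fin d, n ≤ l → y l = 0)
    (hy : ∀ x ∈ nakajimaPolytope m n, 0 ≤ evalForm d y x) :
    ∃ u v : ℕ → ℕ, y = ∑ k ∈ Finset.range n, (u k • coordForm d k + v k • boundForm m k) := by
  induction n generalizing y with
  | zero => exact absurd rfl hn
  | succ n ih =>
    have extend : ∀ (z : Fin d → ℤ) (a b : ℕ), y = z + (a • coordForm d n + b • boundForm m n) →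
        (∃ u v : ℕ → ℕ, z = ∑ k ∈ Finset.range n, (u k • coordForm d k + v k • boundForm m k)) →
        ∃ u v : ℕ → ℕ,
          y = ∑ k ∈ Finset.range (n + 1), (u k • coordForm d k + v k • boundForm m k) := by
      rintro z a b rfl ⟨u, v, rfl⟩
      refine ⟨fun k => if k = n then a else u k, fun k => if k = n then b else v k, ?_⟩
      simp only [Finset.sum_range_succ, if_true]
      congr 1
      refine Finset.sum_congr rfl fun k hk => ?_
      have : k ≠ n := (Finset.mem_range.1 hk).ne
      rw [if_neg this, if_neg this]
    have hcoord : ∀ l : Fin d, coordForm d n l = if (l : ℕ) = n then 1 else 0 := fun _ => rfl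
    rcases eq_or_ne n 0 with rfl | h0
    · have hpos := hy _ rfl
      rw [evalForm_apply, Finset.sum_eq_single ⟨0, hnd⟩
        (fun l _ hl => by rw [hy0 l (by have := mt Fin.ext hl; simp at this; omega)]; simp)
        (by simp)] at hpos
      simp only [if_true, mul_one] at hpos
      have hpos : 0 ≤ y ⟨0, hnd⟩ := by exact_mod_cast hpos
      refine extend 0 (y ⟨0, hnd⟩).toNat 0 ?_ ⟨0, 0, rfl⟩
      funext l
      by_cases hl : (l : ℕ) = 0
      · obtain rfl : l = ⟨0, hnd⟩ := Fin.ext hl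
        simp [hcoord, hpos]
      · simp [hcoord, hl, hy0 l (by omega)]
    · have hn' : n < d := hnd
      set s : ℤ := y ⟨n, hn'⟩
      have hs' : ∀ l : Fin d, (l : ℕ) = n → y l = s := by
        intro l hl
        obtain rfl : l = ⟨n, hn'⟩ := Fin.ext hl
        rfl
      rcases le_total 0 s with h | h
      · refine extend (y - s.toNat • coordForm d n) s.toNat 0 (by simp) (ih h0 hn'.le _ ?_ ?_)
        · intro l hl
          by_cases hln : (l : ℕ) = n
          · simp [hcoord, hln, hs' l hln, h]
          · simp [hcoord, hln, hy0 l (by omega)]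
        · intro x hx
          have h1 := hy x (nakajimaPolytope_subset_succ m h0 hx)
          have h2 := (nakajimaPolytope_bounds hm h0 hn'.le x hx ⟨n, hn'⟩).2.1 le_rfl
          rw [map_sub, map_nsmul, LinearMap.sub_apply, LinearMap.smul_apply,
            evalForm_coordForm hn', h2, smul_zero, sub_zero]
          exact h1
      · have hb : boundForm m n = rowForm m n - coordForm d n := if_neg h0
        have hz0 : ∀ l : Fin d, n ≤ l → (y - (-s).toNat • boundForm m n) l = 0 := by
          intro l hl
          have hr := rowForm_eq_zero hm hl
          by_cases hln : (l : ℕ) = n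
          · simp [hb, hcoord, hln, hs' l hln, hr, h]
          · simp [hb, hcoord, hln, hy0 l (by omega), hr]
        refine extend (y - (-s).toNat • boundForm m n) 0 (-s).toNat (by simp)
          (ih h0 hn'.le _ hz0 ?_)
        intro x hx
        have h1 := hy _ (graphPoint_mem m h0 hx)
        rw [← evalForm_graphPoint m (fun l hl => hz0 l hl.ge), map_sub, map_nsmul, hb, map_sub,
          LinearMap.sub_apply, LinearMap.smul_apply, LinearMap.sub_apply, evalForm_rowForm,
          evalForm_coordForm hn', rowPairing_graphPoint hm le_rfl]
        simpa [graphPoint] using h1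

theorem coordForm_nonneg {m : Matrix (Fin (d - 1)) (Fin d) ℤ} (hm : IsAdmissible m) (k : ℕ) :
    ∀ x ∈ nakajimaPolytope m d, 0 ≤ evalForm d (coordForm d k) x := by
  intro x hx
  by_cases hk : k < d
  · rw [evalForm_coordForm hk]
    exact (nakajimaPolytope_bounds hm (by omega) le_rfl x hx ⟨k, hk⟩).2.2.1
  · have : coordForm d k = 0 := funext fun l => if_neg (by omega)
    simp [this]

theorem boundForm_nonneg {m : Matrix (Fin (d - 1)) (Fin d) ℤ} (hm : IsAdmissible m) {k : ℕ}
    (hk : k < d) : ∀ x ∈ nakajimaPolytope m d, 0 ≤ evalForm d (boundForm m k) x := by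
  intro x hx
  by_cases h0 : k = 0
  · simp [boundForm, h0]
  · rw [boundForm, if_neg h0, map_sub, LinearMap.sub_apply, evalForm_rowForm,
      evalForm_coordForm hk, sub_nonneg]
    exact (nakajimaPolytope_bounds hm (by omega) le_rfl x hx ⟨k, hk⟩).2.2.2 h0 hk

/-- Since `m_n` is not zero, it does not vanish identically on `P_m^{(n)}`; so a point of the graph
differs from its projection by a nonzero multiple of the next basis vector. -/
theorem span_nakajimaPolytope {m : Matrix (Fin (d - 1)) (Fin d) ℤ} (hm : IsAdmissible m)
    {n : ℕ} (hn : n ≠ 0) (hnd : n ≤ d) (k : Fin d) (hk : k < n) :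
    Pi.single k 1 ∈ Submodule.span ℝ (nakajimaPolytope m n) := by
  induction n generalizing k with
  | zero => exact absurd rfl hn
  | succ n ih =>
    rcases eq_or_ne n 0 with rfl | h0
    · refine Submodule.subset_span ?_
      change _ = _
      funext l
      have : l = k ↔ (l : ℕ) = 0 := by rw [Fin.ext_iff]; omega
      simp [Pi.single_apply, this]
    · have hmono := Submodule.span_mono (R := ℝ) (nakajimaPolytope_subset_succ m h0)
      rcases Nat.lt_or_ge k n with h | h
      · exact hmono (ih h0 (by omega) k h)
      · obtain ⟨x, hx, hx0⟩ : ∃ x ∈ nakajimaPolytope m n, rowPairing m n x ≠ 0 := by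
          by_contra! hzero
          have hle : Submodule.span ℝ (nakajimaPolytope m n) ≤
              LinearMap.ker (evalForm d (rowForm m n)) :=
            Submodule.span_le.2 fun x hx => by
              simpa [evalForm_rowForm] using hzero x hx
          refine hm.1.1 ⟨n - 1, by omega⟩ (funext fun l => ?_)
          have hentry : rowForm m n l = m ⟨n - 1, by omega⟩ l := by
            rw [rowForm, entry, dif_pos (by omega)]
            rfl
          rw [← hentry]
          rcases Nat.lt_or_ge l n with hl | hl
          · have := hle (ih h0 (by omega) l hl)
            rw [LinearMap.mem_ker, evalForm_apply] at this
            simpa [Pi.single_apply] using this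
          · exact rowForm_eq_zero hm hl
        have hmem : graphPoint m n x - x ∈ Submodule.span ℝ (nakajimaPolytope m (n + 1)) :=
          sub_mem (Submodule.subset_span (graphPoint_mem m h0 hx))
            (hmono (Submodule.subset_span hx))
        have heq : Pi.single k 1 = (rowPairing m n x)⁻¹ • (graphPoint m n x - x) := by
          funext l
          by_cases hl : l = k
          · subst hl
            have hln : (l : ℕ) = n := by omega
            have := (nakajimaPolytope_bounds hm h0 (by omega) x hx l).2.1 h
            simp [graphPoint, hln, this, hx0]
          · have : (l : ℕ) ≠ n := fun h' => hl (Fin.ext (by omega))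
            simp [graphPoint, this, hl]
        rw [heq]
        exact Submodule.smul_mem _ _ hmem

theorem span_nakajimaPolytope_eq_top {m : Matrix (Fin (d - 1)) (Fin d) ℤ} (hm : IsAdmissible m)
    (hd : d ≠ 0) : Submodule.span ℝ (nakajimaPolytope m d) = ⊤ := by
  rw [eq_top_iff, ← (Pi.basisFun ℝ (Fin d)).span_eq, Submodule.span_le]
  rintro _ ⟨k, rfl⟩
  rw [Pi.basisFun_apply]
  exact span_nakajimaPolytope hm hd le_rfl k k.2

/-! ### The exponents `λ` and `μ` -/

theorem lam_nonpos (m : Matrix (Fin (d - 1)) (Fin d) ℤ) (i j : ℕ) : lam m i j ≤ 0 := by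
  rw [lam_eq]
  split_ifs
  · exact le_rfl
  · exact min_le_left _ _

theorem mu_add_lam (m : Matrix (Fin (d - 1)) (Fin d) ℤ) (i j : ℕ) :
    mu m i j + lam m i j =
      entry m j (i + 1) + ∑ k ∈ Finset.Ioo i j, entry m k (i + 1) * lam m k j := by
  rw [mu, lam_eq]
  split_ifs with h
  · subst h; simp
  · rw [add_comm, min_add_max, zero_add]

theorem mu_eq_zero_or_lam_eq_zero (m : Matrix (Fin (d - 1)) (Fin d) ℤ) {i : ℕ} (hi : i ≠ 0)
    (j : ℕ) : mu m i j = 0 ∨ lam m i j = 0 := by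
  rw [mu, lam_eq, if_neg hi, if_neg hi]
  rcases le_total 0 (entry m j (i + 1) +
    ∑ k ∈ Finset.Ioo i j, entry m k (i + 1) * lam m k j) with h | h
  · exact Or.inr (min_eq_left h)
  · exact Or.inl (max_eq_left h)

/-- The exponents express the form `m_j` through the coordinate and the bound forms of smaller
index. -/
theorem rowForm_eq_sum {m : Matrix (Fin (d - 1)) (Fin d) ℤ} (hm : IsAdmissible m) (j : ℕ) :
    rowForm m j =
      ∑ i ∈ Finset.range j, (mu m i j • coordForm d i + (-lam m i j) • boundForm m i) := by
  funext l
  have hzero : lam m 0 j = 0 := by rw [lam_eq, if_pos rfl]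
  have hterm : ∀ i, (mu m i j • coordForm d i + (-lam m i j) • boundForm m i) l =
      (if (l : ℕ) = i then mu m i j + lam m i j else 0) -
        entry m i (l + 1) * lam m i j := by
    intro i
    rcases eq_or_ne i 0 with rfl | h0
    · simp [hzero, coordForm]
    · simp only [boundForm, if_neg h0, rowForm, coordForm, Pi.add_apply, Pi.smul_apply,
        Pi.sub_apply, smul_eq_mul]
      split_ifs <;> ring
  rw [Finset.sum_apply]
  simp only [hterm]
  rw [Finset.sum_sub_distrib, Finset.sum_ite_eq]
  rcases Nat.lt_or_ge l j with h | h
  · rw [if_pos (Finset.mem_range.2 h), mu_add_lam]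
    have : ∑ i ∈ Finset.range j, entry m i (l + 1) * lam m i j =
        ∑ k ∈ Finset.Ioo (l : ℕ) j, entry m k (l + 1) * lam m k j := by
      refine (Finset.sum_subset (fun k hk => ?_) fun k _ hk => ?_).symm
      · exact Finset.mem_range.2 (Finset.mem_Ioo.1 hk).2
      · rw [hm.1.2 k (l + 1), zero_mul]
        simp_all
    rw [this, rowForm, add_sub_cancel_right]
  · rw [if_neg (by simpa using h), Finset.sum_eq_zero, sub_zero, rowForm_eq_zero hm h]
    intro i hi
    rw [hm.1.2 i (l + 1), zero_mul]
    have := Finset.mem_range.1 hi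
    omega

/-- `μ_{0,j}` is the value of `m_j` at the point of `P_m^{(j)}` where all other terms of
`rowForm_eq_sum` vanish. -/
theorem mu_nonneg {m : Matrix (Fin (d - 1)) (Fin d) ℤ} (hm : IsAdmissible m) (i : ℕ) {j : ℕ}
    (hj : j ≠ 0) (hjd : j ≤ d - 1) : 0 ≤ mu m i j := by
  rcases eq_or_ne i 0 with rfl | hi
  · obtain ⟨x, hx, hxk⟩ := exists_vertex hm (fun k => mu m k j = 0) hj (by omega)
    have hpos := hm.2 j (by omega) hjd x hx
    have hval : rowPairing m j x = mu m 0 j := by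
      rw [← evalForm_rowForm, rowForm_eq_sum hm, map_sum, LinearMap.sum_apply,
        Finset.sum_eq_single 0]
      · have h0 : (0 : ℕ) < d := by omega
        simp only [boundForm, if_true, smul_zero, add_zero, map_zsmul, LinearMap.smul_apply,
          evalForm_coordForm h0]
        rw [(nakajimaPolytope_bounds hm hj (by omega) x hx ⟨0, h0⟩).1 rfl]
        simp
      · intro k hk hk0
        have hkj := Finset.mem_range.1 hk
        have hkd : k < d := by omega
        rw [boundForm, if_neg hk0, map_add, map_zsmul, map_zsmul, map_sub, LinearMap.add_apply,
          LinearMap.smul_apply, LinearMap.smul_apply, LinearMap.sub_apply, evalForm_rowForm,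
          evalForm_coordForm hkd]
        have hxk := hxk ⟨k, hkd⟩ hk0 hkj
        by_cases hmu : mu m k j = 0
        · rw [hxk.1 hmu, hmu]
          simp
        · rw [hxk.2 hmu, (mu_eq_zero_or_lam_eq_zero m hk0 j).resolve_left hmu]
          simp
      · intro h
        exact absurd (Finset.mem_range.2 (by omega)) h
    rw [hval] at hpos
    exact_mod_cast hpos
  · rw [mu, if_neg hi]
    exact le_max_left _ _

/-! ### Lattice equivalence and dual monoids -/

theorem single_mem_stdLattice (k : Fin d) : (Pi.single k 1 : Fin d → ℝ) ∈ stdLattice d :=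
  ⟨Pi.single k 1, funext fun l => by by_cases h : l = k <;> simp [h]⟩

theorem add_mem_stdLattice {x y : Fin d → ℝ} (hx : x ∈ stdLattice d) (hy : y ∈ stdLattice d) :
    x + y ∈ stdLattice d := by
  obtain ⟨a, rfl⟩ := hx
  obtain ⟨b, rfl⟩ := hy
  exact ⟨a + b, funext fun l => by simp⟩

theorem sub_mem_stdLattice {x y : Fin d → ℝ} (hx : x ∈ stdLattice d) (hy : y ∈ stdLattice d) :
    x - y ∈ stdLattice d := by
  obtain ⟨a, rfl⟩ := hx
  obtain ⟨b, rfl⟩ := hy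
  exact ⟨a - b, funext fun l => by simp⟩

/-- A subset of the hyperplane `x_1 = 1` that spans `ℝ^d` linearly spans the hyperplane affinely. -/
theorem affineSpan_eq_hyperplaneOne (o : Fin d) (ho : (o : ℕ) = 0) {Q : Set (Fin d → ℝ)}
    (hQ : Q ⊆ hyperplaneOne d) (hspan : Submodule.span ℝ Q = ⊤) :
    (affineSpan ℝ Q : Set (Fin d → ℝ)) = hyperplaneOne d := by
  apply Set.Subset.antisymm
  · intro x hx k hk
    refine affineSpan_induction (p := fun x : Fin d → ℝ => x k = 1) hx (fun x hx => hQ hx k hk) ?_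
    intro c u v w hu hv hw
    simp [hu, hv, hw]
  · obtain ⟨q, hq⟩ : Q.Nonempty := by
      by_contra hne
      rw [Set.not_nonempty_iff_eq_empty.1 hne, Submodule.span_empty] at hspan
      have : (Pi.single o 1 : Fin d → ℝ) ∈ (⊥ : Submodule ℝ (Fin d → ℝ)) := hspan ▸ trivial
      simp at this
    intro x hx
    have key : ∀ y ∈ Submodule.span ℝ Q, y - y o • q ∈ vectorSpan ℝ Q := by
      intro y hy
      induction hy using Submodule.span_induction with
      | mem y hy =>
        rw [hQ hy o ho, one_smul]
        exact vsub_mem_vectorSpan ℝ hy hq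
      | zero => simp
      | add y z _ _ hy hz =>
        have := add_mem hy hz
        rwa [sub_add_sub_comm, ← add_smul] at this
      | smul c y _ hy =>
        have := Submodule.smul_mem _ c hy
        rwa [smul_sub, smul_smul] at this
    have := key x (hspan ▸ trivial)
    rw [hx o ho, one_smul] at this
    have h := vadd_mem_affineSpan_of_mem_affineSpan_of_mem_vectorSpan
      (subset_affineSpan ℝ Q hq) this
    simpa using h

theorem evalForm_map_of_matrix {L : (Fin d → ℝ) →ₗ[ℝ] (Fin d → ℝ)} {A : Matrix (Fin d) (Fin d) ℤ}
    (hA : ∀ k i, (A i k : ℝ) = L (Pi.single k 1) i) (y : Fin d → ℤ) (x : Fin d → ℝ) :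
    evalForm d (Matrix.vecMul y A) x = evalForm d y (L x) := by
  suffices h : evalForm d (Matrix.vecMul y A) = evalForm d y ∘ₗ L from
    LinearMap.congr_fun h x
  refine LinearMap.pi_ext' fun k => LinearMap.ext_ring ?_
  simp only [LinearMap.comp_apply, LinearMap.single_apply, evalForm_apply, ← hA]
  simp [Matrix.vecMul, dotProduct, Pi.single_apply]

/-- A lattice equivalence between polytopes of full dimension in the hyperplane `x_1 = 1` extends to
a linear automorphism of `ℝ^d` preserving `ℤ^d`; the transposed integral matrix then identifies the
dual monoids of the two cones. -/
theorem nonempty_dualMonoid_equiv (hd : d ≠ 0) {P Q : Set (Fin d → ℝ)}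
    (hP : P ⊆ hyperplaneOne d) (hQ : Q ⊆ hyperplaneOne d) (hspan : Submodule.span ℝ Q = ⊤)
    (h : LatticeEquivalent P Q) :
    Nonempty (dualMonoid (coneOver Q) ≃+ dualMonoid (coneOver P)) := by
  obtain ⟨w, -, hwPQ, hwZ⟩ := h
  let o : Fin d := ⟨0, Nat.pos_of_ne_zero hd⟩
  have ho : (o : ℕ) = 0 := rfl
  -- The linear map that agrees with `w` on the hyperplane `x_1 = 1`.
  let L : (Fin d → ℝ) →ₗ[ℝ] (Fin d → ℝ) := w.linear + (LinearMap.proj o).smulRight (w 0)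
  have hL : ∀ x ∈ hyperplaneOne d, L x = w x := by
    intro x hx
    have h1 : w x = w.linear x + w 0 := congrFun (AffineMap.decomp w) x
    simp [L, hx o ho, h1]
  have hLPQ : L '' P = Q := by
    rw [← hwPQ]
    exact Set.image_congr fun x hx => hL x (hP hx)
  have hmap : (Submodule.span ℝ P).map L = ⊤ := by rw [Submodule.map_span, hLPQ, hspan]
  have hsurj : Function.Surjective L := by
    rw [← LinearMap.range_eq_top, eq_top_iff, ← hmap]
    exact LinearMap.map_le_range
  have hinj : Function.Injective L := LinearMap.injective_iff_surjective.2 hsurj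
  have hspanP : Submodule.span ℝ P = ⊤ := by
    refine Submodule.map_injective_of_injective hinj ?_
    rw [hmap, Submodule.map_top, LinearMap.range_eq_top.2 hsurj]
  rw [affineSpan_eq_hyperplaneOne o ho hP hspanP, affineSpan_eq_hyperplaneOne o ho hQ hspan] at hwZ
  -- Points of the hyperplane through which `ℤ^d` is generated.
  have hbase : (Pi.single o 1 : Fin d → ℝ) ∈ hyperplaneOne d ∩ stdLattice d :=
    ⟨fun k hk => by obtain rfl : k = o := Fin.ext hk
                    simp, single_mem_stdLattice o⟩
  have hshift : ∀ k, k ≠ o →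
      (Pi.single o 1 + Pi.single k 1 : Fin d → ℝ) ∈ hyperplaneOne d ∩ stdLattice d := fun k hk =>
    ⟨fun l hl => by obtain rfl : l = o := Fin.ext hl
                    simp [hk.symm],
      add_mem_stdLattice (single_mem_stdLattice o) (single_mem_stdLattice k)⟩
  have hmaps : ∀ x ∈ hyperplaneOne d ∩ stdLattice d, L x ∈ stdLattice d := by
    intro x hx
    have : w x ∈ hyperplaneOne d ∩ stdLattice d := hwZ ▸ Set.mem_image_of_mem w hx
    rw [hL x hx.1]
    exact this.2
  have hlift : ∀ y ∈ hyperplaneOne d ∩ stdLattice d, ∃ x ∈ stdLattice d, L x = y := by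
    intro y hy
    rw [← hwZ] at hy
    obtain ⟨x, hx, rfl⟩ := hy
    exact ⟨x, hx.2, hL x hx.1⟩
  have hcol : ∀ k, ∃ a : Fin d → ℤ, ∀ i, (a i : ℝ) = L (Pi.single k 1) i := by
    intro k
    suffices L (Pi.single k 1) ∈ stdLattice d by
      obtain ⟨a, ha⟩ := this
      exact ⟨a, fun i => congrFun ha i⟩
    by_cases hk : k = o
    · rw [hk]
      exact hmaps _ hbase
    · have := sub_mem_stdLattice (hmaps _ (hshift k hk)) (hmaps _ hbase)
      rwa [← map_sub, add_sub_cancel_left] at this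
  have hcol' : ∀ k, ∃ b : Fin d → ℤ, L (fun i => (b i : ℝ)) = Pi.single k 1 := by
    intro k
    suffices ∃ x ∈ stdLattice d, L x = Pi.single k 1 by
      obtain ⟨_, ⟨b, rfl⟩, hb⟩ := this
      exact ⟨b, hb⟩
    by_cases hk : k = o
    · rw [hk]
      exact hlift _ hbase
    · obtain ⟨x, hx, hx'⟩ := hlift _ (hshift k hk)
      obtain ⟨y, hy, hy'⟩ := hlift _ hbase
      exact ⟨x - y, sub_mem_stdLattice hx hy, by rw [map_sub, hx', hy', add_sub_cancel_left]⟩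
  choose a ha using hcol
  choose b hb using hcol'
  let A : Matrix (Fin d) (Fin d) ℤ := Matrix.of fun i k => a k i
  let B : Matrix (Fin d) (Fin d) ℤ := Matrix.of fun i k => b k i
  have hA : ∀ k i, (A i k : ℝ) = L (Pi.single k 1) i := ha
  have hAB : A * B = 1 := by
    ext i k
    have h1 := congrFun (hb k) i
    have h2 := evalForm_map_of_matrix hA (Pi.single i 1) fun l => (b k l : ℝ)
    rw [hb] at h2
    simp only [evalForm_apply, Matrix.single_one_vecMul] at h2
    have h3 : ((∑ l, A i l * B l k : ℤ) : ℝ) = ((1 : Matrix (Fin d) (Fin d) ℤ) i k : ℤ) := by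
      push_cast
      refine h2.trans ?_
      simp [Pi.single_apply, Matrix.one_apply, eq_comm]
    rw [Matrix.mul_apply]
    exact_mod_cast h3
  have hBA : B * A = 1 := mul_eq_one_comm.1 hAB
  have hmem : ∀ y, y ∈ dualMonoid (coneOver Q) ↔ Matrix.vecMul y A ∈ dualMonoid (coneOver P) := by
    intro y
    simp only [mem_dualMonoid_coneOver, evalForm_map_of_matrix hA, ← hLPQ, Set.forall_mem_image]
  refine ⟨{ toFun := fun y => ⟨Matrix.vecMul y.1 A, (hmem _).1 y.2⟩
            invFun := fun y => ⟨Matrix.vecMul y.1 B, (hmem _).2 ?_⟩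
            left_inv := fun y => Subtype.ext ?_
            right_inv := fun y => Subtype.ext ?_
            map_add' := fun y z => Subtype.ext (Matrix.add_vecMul A y.1 z.1) }⟩
  · rw [Matrix.vecMul_vecMul, hBA, Matrix.vecMul_one]
    exact y.2
  · simp only [Matrix.vecMul_vecMul, hAB, Matrix.vecMul_one]
  · simp only [Matrix.vecMul_vecMul, hBA, Matrix.vecMul_one]

/-! ### The binomial presentation of the dual monoid -/

/-- The indices `0, …, 2d - 2` consist of `k` for `k < d` and of `d + k - 1` for `1 ≤ k < d`. -/
@[to_additive]
theorem prod_fin_double_pred {M : Type*} [CommMonoid M] (hd : d ≠ 0) (G : ℕ → M) :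
    ∏ i : Fin (2 * d - 1), G i =
      ∏ k ∈ Finset.range d, (G k * if k = 0 then 1 else G (d + k - 1)) := by
  obtain ⟨n, rfl⟩ := Nat.exists_eq_succ_of_ne_zero hd
  rw [Fin.prod_univ_eq_prod_range G, show 2 * n.succ - 1 = (n + 1) + n by omega,
    Finset.prod_range_add, Finset.prod_mul_distrib, Finset.prod_range_succ' (fun k => ite _ _ _)]
  simp

/-- The exponent of `z_{n+1}` (zero if there is no such variable). -/
def exponent (a : Fin (2 * d - 1) →₀ ℕ) (n : ℕ) : ℕ :=
  if h : n < 2 * d - 1 then a ⟨n, h⟩ else 0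

theorem exponent_val (a : Fin (2 * d - 1) →₀ ℕ) (i : Fin (2 * d - 1)) : exponent a i = a i :=
  dif_pos i.2

theorem monomial_eq_prod_zvar (hd : d ≠ 0) (a : Fin (2 * d - 1) →₀ ℕ) :
    (MvPolynomial.monomial a 1 : MvPolynomial (Fin (2 * d - 1)) ℂ) =
      ∏ k ∈ Finset.range d, (zvar d (k + 1) ^ exponent a k *
        if k = 0 then 1 else zvar d (d + k) ^ exponent a (d + k - 1)) := by
  rw [MvPolynomial.monomial_eq, Finsupp.prod_fintype _ _ (fun _ => pow_zero _), map_one, one_mul]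
  have h := prod_fin_double_pred hd fun n => zvar d (n + 1) ^ exponent a n
  refine Eq.trans (Finset.prod_congr rfl fun i _ => ?_)
    (h.trans (Finset.prod_congr rfl fun k _ => ?_))
  · rw [exponent_val, zvar, dif_pos (by omega)]
    rfl
  · split_ifs with hk
    · rfl
    · rw [show d + k - 1 + 1 = d + k by omega]

/-- The generators of the dual monoid of the Nakajima cone, indexed like the variables. -/
def dualGenerator {m : Matrix (Fin (d - 1)) (Fin d) ℤ} (hm : IsAdmissible m)
    (i : Fin (2 * d - 1)) : dualMonoid (coneOver (nakajimaPolytope m d)) :=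
  ⟨if (i : ℕ) < d then coordForm d i else boundForm m (i + 1 - d), by
    rw [mem_dualMonoid_coneOver]
    split_ifs
    · exact coordForm_nonneg hm i
    · exact boundForm_nonneg hm (by omega)⟩

/-- The weight of a monomial: the element of the dual monoid it is mapped to. -/
noncomputable def weight {m : Matrix (Fin (d - 1)) (Fin d) ℤ} (hm : IsAdmissible m) :
    (Fin (2 * d - 1) →₀ ℕ) →+ dualMonoid (coneOver (nakajimaPolytope m d)) :=
  (Finsupp.linearCombination ℕ (dualGenerator hm)).toAddMonoidHom

theorem weight_single {m : Matrix (Fin (d - 1)) (Fin d) ℤ} (hm : IsAdmissible m)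
    (i : Fin (2 * d - 1)) : weight hm (Finsupp.single i 1) = dualGenerator hm i := by
  simp [weight]

theorem coe_weight (hd : d ≠ 0) {m : Matrix (Fin (d - 1)) (Fin d) ℤ} (hm : IsAdmissible m)
    (a : Fin (2 * d - 1) →₀ ℕ) : (weight hm a : Fin d → ℤ) = ∑ k ∈ Finset.range d,
      (exponent a k • coordForm d k + exponent a (d + k - 1) • boundForm m k) := by
  have h := sum_fin_double_pred hd fun n =>
    exponent a n • if n < d then coordForm d n else boundForm m (n + 1 - d)
  have h' : weight hm a = ∑ i, a i • dualGenerator hm i := by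
    simp [weight, Finsupp.linearCombination_apply, Finsupp.sum_fintype]
  rw [h', AddSubmonoid.coe_finsetSum]
  refine Eq.trans (Finset.sum_congr rfl fun i _ => ?_)
    (h.trans (Finset.sum_congr rfl fun k hk => ?_))
  · rw [exponent_val]
    rfl
  · rw [if_pos (Finset.mem_range.1 hk)]
    split_ifs with h0 h1
    · simp [h0, boundForm]
    · omega
    · rw [show d + k - 1 + 1 - d = k by omega]

theorem weight_surjective (hd : d ≠ 0) {m : Matrix (Fin (d - 1)) (Fin d) ℤ}
    (hm : IsAdmissible m) : Function.Surjective (weight hm) := by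
  rintro ⟨y, hy⟩
  obtain ⟨u, v, huv⟩ := exists_generators hm hd le_rfl y (fun l hl => by omega)
    (mem_dualMonoid_coneOver.1 hy)
  refine ⟨Finsupp.equivFunOnFinite.symm fun i => if (i : ℕ) < d then u i else v (i + 1 - d),
    Subtype.ext ?_⟩
  rw [coe_weight hd]
  refine Eq.trans (Finset.sum_congr rfl fun k hk => ?_) huv.symm
  have hkd := Finset.mem_range.1 hk
  congr 1
  · rw [exponent, dif_pos (by omega)]
    simp [hkd]
  · rcases eq_or_ne k 0 with rfl | h0
    · simp [boundForm]
    · rw [exponent, dif_pos (by omega)]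
      simp [show ¬ d + k - 1 < d by omega, show d + k - 1 + 1 - d = k by omega]

theorem coordForm_add_boundForm {m : Matrix (Fin (d - 1)) (Fin d) ℤ} (hm : IsAdmissible m) {j : ℕ}
    (hj : j ≠ 0) (hjd : j < d) : coordForm d j + boundForm m j = ∑ i ∈ Finset.range j,
      ((mu m i j).toNat • coordForm d i + (-lam m i j).toNat • boundForm m i) := by
  rw [boundForm, if_neg hj, add_sub_cancel, rowForm_eq_sum hm]
  refine Finset.sum_congr rfl fun i _ => ?_
  rw [← natCast_zsmul, ← natCast_zsmul, Int.toNat_of_nonneg (mu_nonneg hm i hj (by omega)),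
    Int.toNat_of_nonneg (neg_nonneg.2 (lam_nonpos m i j))]

theorem binomial_eq (m : Matrix (Fin (d - 1)) (Fin d) ℤ) (j : ℕ) :
    binomial m j = (∏ i ∈ Finset.range j,
      zvar d (i + 1) ^ (mu m i j).toNat * zvar d (d + i) ^ (-lam m i j).toNat) -
        zvar d (j + 1) * zvar d (d + j) := by
  rw [binomial]
  congr 1
  refine Finset.prod_nbij' (· - 1) (· + 1) ?_ ?_ ?_ ?_ ?_
  · intro i hi
    simp only [Finset.mem_Icc, Finset.mem_range] at hi ⊢
    omega
  · intro i hi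
    simp only [Finset.mem_Icc, Finset.mem_range] at hi ⊢
    omega
  · intro i hi
    simp only [Finset.mem_Icc] at hi
    omega
  · intro i _
    rfl
  · intro i hi
    have := (Finset.mem_Icc.1 hi).1
    rw [Nat.sub_add_cancel this, Nat.add_sub_assoc this]

/-- The binomials vanish under the map sending each variable to its weight. -/
theorem binomialIdeal_le_ker {m : Matrix (Fin (d - 1)) (Fin d) ℤ} (hm : IsAdmissible m) :
    binomialIdeal m ≤ RingHom.ker (AddMonoidAlgebra.mapDomainAlgHom ℂ ℂ (weight hm) :
      MvPolynomial (Fin (2 * d - 1)) ℂ →ₐ[ℂ] _) := by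
  set ψ : MvPolynomial (Fin (2 * d - 1)) ℂ →ₐ[ℂ] _ :=
    AddMonoidAlgebra.mapDomainAlgHom ℂ ℂ (weight hm) with hψ
  have hX : ∀ i, ψ (MvPolynomial.X i) =
      AddMonoidAlgebra.of ℂ _ (Multiplicative.ofAdd (dualGenerator hm i)) := by
    intro i
    rw [← weight_single]
    exact AddMonoidAlgebra.mapDomain_single
  rw [binomialIdeal, Ideal.span_le]
  rintro _ ⟨j, ⟨hj, hjd⟩, rfl⟩
  -- The elements of the dual monoid to which `z_{i+1}` and `z_{d+i}` are mapped.
  let e : ℕ → dualMonoid (coneOver (nakajimaPolytope m d)) := fun i =>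
    if h : i < d then dualGenerator hm ⟨i, by omega⟩ else 0
  let f : ℕ → dualMonoid (coneOver (nakajimaPolytope m d)) := fun i =>
    if h : i ≠ 0 ∧ i < d then dualGenerator hm ⟨d + i - 1, by omega⟩ else 0
  have he : ∀ i < d, (e i : Fin d → ℤ) = coordForm d i := by
    intro i hi
    simp [e, hi, dualGenerator]
  have hf : ∀ i < d, (f i : Fin d → ℤ) = boundForm m i := by
    intro i hi
    rcases eq_or_ne i 0 with rfl | h0
    · simp [f, boundForm]
    · simp [f, hi, h0, dualGenerator, show ¬ d + i - 1 < d by omega,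
        show d + i - 1 + 1 - d = i by omega]
  have hze : ∀ i < d,
      ψ (zvar d (i + 1)) = AddMonoidAlgebra.of ℂ _ (Multiplicative.ofAdd (e i)) := by
    intro i hi
    rw [zvar, dif_pos (by omega), hX]
    simp [e, hi]
  have hzf : ∀ i < d, i ≠ 0 →
      ψ (zvar d (d + i)) = AddMonoidAlgebra.of ℂ _ (Multiplicative.ofAdd (f i)) := by
    intro i hi h0
    rw [zvar, dif_pos (by omega), hX]
    simp [f, hi, h0]
  have hsum : e j + f j =
      ∑ i ∈ Finset.range j, ((mu m i j).toNat • e i + (-lam m i j).toNat • f i) := by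
    refine Subtype.ext ?_
    rw [AddSubmonoid.coe_add, he j (by omega), hf j (by omega),
      coordForm_add_boundForm hm (by omega) (by omega), AddSubmonoid.coe_finsetSum]
    refine Finset.sum_congr rfl fun i hi => ?_
    have := Finset.mem_range.1 hi
    rw [AddSubmonoid.coe_add, AddSubmonoidClass.coe_nsmul, AddSubmonoidClass.coe_nsmul,
      he i (by omega), hf i (by omega)]
  change ψ (binomial m j) = 0
  rw [binomial_eq, map_sub, sub_eq_zero, map_mul, hze j (by omega), hzf j (by omega) (by omega),
    ← map_mul, ← ofAdd_add, hsum, ofAdd_sum, map_prod, map_prod]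
  refine Finset.prod_congr rfl fun i hi => ?_
  have := Finset.mem_range.1 hi
  rw [map_mul, map_pow, map_pow, hze i (by omega), ofAdd_add, ofAdd_nsmul, ofAdd_nsmul, map_mul,
    map_pow, map_pow]
  congr 1
  rcases eq_or_ne i 0 with rfl | h0
  · have : lam m 0 j = 0 := by rw [lam_eq, if_pos rfl]
    simp [this]
  · rw [hzf i (by omega) h0]

theorem monomial_sub_mem_binomialIdeal (hd : d ≠ 0) {m : Matrix (Fin (d - 1)) (Fin d) ℤ}
    (hm : IsAdmissible m) (a b : Fin (2 * d - 1) →₀ ℕ) (hab : weight hm a = weight hm b) :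
    MvPolynomial.monomial a (1 : ℂ) - MvPolynomial.monomial b 1 ∈ binomialIdeal m := by
  let π := Ideal.Quotient.mk (binomialIdeal m)
  let E : ℕ → MvPolynomial (Fin (2 * d - 1)) ℂ ⧸ binomialIdeal m := fun k => π (zvar d (k + 1))
  let F : ℕ → MvPolynomial (Fin (2 * d - 1)) ℂ ⧸ binomialIdeal m := fun k =>
    if k = 0 then 1 else π (zvar d (d + k))
  let c : ℕ → (Fin d → ℤ) →+ ℤ := fun n =>
    if h : n < d then Pi.evalAddMonoidHom (fun _ => ℤ) ⟨n, h⟩ else 0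
  have hc : ∀ n (h : n < d) y, c n y = y ⟨n, h⟩ := fun n h y => by simp [c, h]
  have hπ : ∀ a, π (MvPolynomial.monomial a 1) =
      ∏ k ∈ Finset.range d, E k ^ exponent a k * F k ^ exponent a (d + k - 1) := by
    intro a
    rw [monomial_eq_prod_zvar hd, map_prod]
    refine Finset.prod_congr rfl fun k _ => ?_
    by_cases h0 : k = 0 <;> simp [E, F, h0]
  refine Ideal.Quotient.eq.1 ((hπ a).trans (Eq.trans ?_ (hπ b).symm))
  refine prod_eq_of_weight_eq (N := d) (E := E) (F := F) (e := coordForm d) (f := boundForm m)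
    (c := c) (p := fun i j => (mu m i j).toNat) (q := fun i j => (-lam m i j).toNat)
    (if_pos rfl) (if_pos rfl) ?_ ?_ ?_ ?_ ?_ ?_ d le_rfl _ _ _ _ ?_
  · intro n hn i hi
    rw [hc n hn]
    exact if_neg hi.ne'
  · intro n hn i hi
    rw [hc n hn, boundForm]
    split_ifs
    · rfl
    · have h1 : rowForm m i ⟨n, hn⟩ = 0 := rowForm_eq_zero hm hi.le
      have h2 : coordForm d i ⟨n, hn⟩ = 0 := if_neg hi.ne'
      rw [Pi.sub_apply, h1, h2, sub_zero]
  · intro n hn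
    rw [hc n hn]
    exact if_pos rfl
  · intro n hn h0
    have h1 : rowForm m n ⟨n, hn⟩ = 0 := rowForm_eq_zero hm le_rfl
    have h2 : coordForm d n ⟨n, hn⟩ = 1 := if_pos rfl
    rw [hc n hn, boundForm, if_neg h0, Pi.sub_apply, h1, h2, zero_sub]
  · intro n hn h0
    have hmem : binomial m n ∈ binomialIdeal m :=
      Ideal.subset_span ⟨n, ⟨Nat.pos_of_ne_zero h0, by omega⟩, rfl⟩
    rw [binomial_eq] at hmem
    have hrel := Ideal.Quotient.eq.2 hmem
    rw [map_mul, map_prod] at hrel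
    have hFn : F n = π (zvar d (d + n)) := if_neg h0
    rw [hFn, ← hrel]
    refine Finset.prod_congr rfl fun i _ => ?_
    rw [map_mul, map_pow, map_pow]
    by_cases hi : i = 0
    · have : lam m 0 n = 0 := by rw [lam_eq, if_pos rfl]
      simp [E, hi, this, π]
    · simp [E, F, hi, π]
  · exact fun n hn h0 => coordForm_add_boundForm hm h0 hn
  · rw [← coe_weight hd hm, ← coe_weight hd hm, hab]

end ToricLCI

theorem theorem3p1 (d : ℕ) (hd : 3 ≤ d)
    (m : Matrix (Fin (d - 1)) (Fin d) ℤ) (hm : ToricLCI.IsAdmissible m)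
    (P : Set (Fin d → ℝ)) (hP : ToricLCI.IsLatticePolytope P)
    (hPH : P ⊆ ToricLCI.hyperplaneOne d)
    (hPm : ToricLCI.LatticeEquivalent P (ToricLCI.nakajimaPolytope m d)) :
    (∀ i j : ℕ, i < j → j ≤ d - 1 → ToricLCI.lam m i j ≤ 0 ∧ 0 ≤ ToricLCI.mu m i j) ∧
    Nonempty (ToricLCI.toricVariety (ToricLCI.coneOver P) ≅
      ToricLCI.toricVariety (ToricLCI.coneOver (ToricLCI.nakajimaPolytope m d))) ∧
    Nonempty (ToricLCI.toricVariety (ToricLCI.coneOver (ToricLCI.nakajimaPolytope m d)) ≅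
      ToricLCI.specOver
        (MvPolynomial (Fin (2 * d - 1)) ℂ ⧸ ToricLCI.binomialIdeal m)) := by
  have hd0 : d ≠ 0 := by omega
  refine ⟨fun i j hij hj => ⟨ToricLCI.lam_nonpos m i j, ToricLCI.mu_nonneg hm i (by omega) hj⟩,
    ?_, ?_⟩
  · obtain ⟨φ⟩ := ToricLCI.nonempty_dualMonoid_equiv hd0 hPH
      (fun x hx k hk => (ToricLCI.nakajimaPolytope_bounds hm hd0 le_rfl x hx k).1 hk)
      (ToricLCI.span_nakajimaPolytope_eq_top hm hd0) hPm
    exact ToricLCI.nonempty_specOver_iso (AddMonoidAlgebra.domCongr ℂ ℂ φ.symm)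
  · obtain ⟨φ⟩ := ToricLCI.nonempty_quotient_algEquiv (ToricLCI.binomialIdeal m)
      (ToricLCI.weight hm) (ToricLCI.weight_surjective hd0 hm)
      (ToricLCI.binomialIdeal_le_ker hm) (ToricLCI.monomial_sub_mem_binomialIdeal hd0 hm)
    exact ToricLCI.nonempty_specOver_iso φ.symm
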